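/- Let $n,r\ge 0$ be integers and $\varepsilon\ge 0$. Let $X$ be an $n$-bit string (the part of Bob's key that he keeps) and let $E$ be a quantum system with complex Hilbert space $\mathcal H_E$ (Eve's system, including all classical information available to her). Let their joint state be $$\rho_{XE}=\sum_{x\in\{0,1\}^n}|x\rangle\langle x|\otimes\rho_E^x ,\qquad \rho_E^x\ge 0,\qquad \sum_x\operatorname{Tr}\rho_E^x=1 .$$ For a positive operator $\tau_{XE}$ on $\mathbb C^{\{0,1\}^n}\otimes\mathcal H_E$ and a density operator $\sigma_E$ on $\mathcal H_E$ put $$H_{\min}(\tau_{XE}|\sigma_E)=\sup\{h\in\mathbb R:\ \tau_{XE}\le 2^{-h}\,1_X\otimes\sigma_E\},$$ and define the smooth min-entropy $$H^{\varepsilon}_{\min}(X|E)_\rho=\sup_{\tau_{XE}}\ \sup_{\sigma_E}\ H_{\min}(\tau_{XE}|\sigma_E),$$ where $\tau_{XE}$ ranges over all positive (not necessarily normalized, not necessarily classical on $X$) operators with $\|\tau_{XE}-\rho_{XE}\|_1\le\varepsilon$ and $\sigma_E$ over all density operators on $\mathcal H_E$. These suprema are taken in $[-\infty,\infty]$, and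 $2^{-\infty}=0$. Then for every strategy of Eve, that is, every measurement (POVM) $(M_f)_{f\in\{0,1\}^n}$ on $\mathcal H_E$ whose outcome $F=f$ is her guess of $X$, the average probability $\langle p_r\rangle$ that the guess has at most $r$ mistakes satisfies $$\langle p_r\rangle=\sum_{x}\ \sum_{f:\ d(x,f)\le r}\operatorname{Tr}\big(M_f\,\rho_E^x\big)\ \le\ \left(\sum_{k=0}^{r}\binom nk\right)2^{-H^{\varepsilon}_{\min}(X|E)_\rho}+\varepsilon ,$$ where $d$ is the Hamming distance. -/

import Mathlib

open scoped ENNReal InnerProductSpace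

noncomputable section

namespace QKey

/-! ### Traces of bounded operators on a complex Hilbert space -/

section Trace

variable {H : Type*} [NormedAddCommGroup H] [InnerProductSpace ℂ H] [CompleteSpace H]

/-- The index set of a fixed Hilbert (orthonormal) basis of `H`. -/
def basisSet (H : Type*) [NormedAddCommGroup H] [InnerProductSpace ℂ H] [CompleteSpace H] :
    Set H :=
  (exists_hilbertBasis ℂ H).choose

/-- A fixed Hilbert (orthonormal) basis of `H`. -/
def stdBasis (H : Type*) [NormedAddCommGroup H] [InnerProductSpace ℂ H] [CompleteSpace H] :
    HilbertBasis (basisSet H) ℂ H :=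
  (exists_hilbertBasis ℂ H).choose_spec.choose

/-- The trace `∑ᵢ ⟨eᵢ, A eᵢ⟩ ∈ [0, ∞]` of a positive bounded operator `A`
(meant for positive `A` only; see `posTrace_eq` for the independence of the basis). -/
def posTrace (A : H →L[ℂ] H) : ℝ≥0∞ :=
  ∑' i, ENNReal.ofReal (⟪stdBasis H i, A (stdBasis H i)⟫_ℂ).re

/-- The trace `∑ᵢ ⟨eᵢ, A eᵢ⟩` of a trace-class operator `A`. -/
def trace (A : H →L[ℂ] H) : ℂ :=
  ∑' i, ⟪stdBasis H i, A (stdBasis H i)⟫_ℂ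

/-- The trace norm `‖A‖₁ = Tr |A|`, with `|A| = √(A* A)`. It is finite exactly when `A` is
trace class. -/
def traceNorm (A : H →L[ℂ] H) : ℝ≥0∞ :=
  posTrace (CFC.abs A)

/-- A density operator: a positive operator of trace one. -/
structure IsDensity (A : H →L[ℂ] H) : Prop where
  nonneg : 0 ≤ A
  trace_eq_one : posTrace A = 1

theorem parseval {ι : Type*} (b : HilbertBasis ι ℂ H) (x : H) :
    ∑' i, ENNReal.ofReal (‖⟪b i, x⟫_ℂ‖ ^ 2) = ENNReal.ofReal (‖x‖ ^ 2) := by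
  have h := (b.hasSum_inner_mul_inner x x).mapL Complex.reCLM
  have h2 : HasSum (fun i => ‖⟪b i, x⟫_ℂ‖ ^ 2) (‖x‖ ^ 2) := by
    convert h using 1
    · ext i
      rw [← inner_conj_symm x (b i), Complex.conj_mul']
      simp [← Complex.ofReal_pow]
    · rw [inner_self_eq_norm_sq_to_K]
      simp [← Complex.ofReal_pow]
  rw [← h2.tsum_eq, ENNReal.ofReal_tsum_of_nonneg (fun i => by positivity) h2.summable]

theorem tsum_normSq_adjoint {ι κ : Type*} (b : HilbertBasis ι ℂ H) (c : HilbertBasis κ ℂ H)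
    (A : H →L[ℂ] H) :
    ∑' i, ENNReal.ofReal (‖A (b i)‖ ^ 2) =
      ∑' j, ENNReal.ofReal (‖(ContinuousLinearMap.adjoint A) (c j)‖ ^ 2) := by
  simp_rw [← parseval c (A _), ← parseval b ((ContinuousLinearMap.adjoint A) _)]
  rw [ENNReal.tsum_comm]
  refine tsum_congr fun j => tsum_congr fun i => ?_
  rw [ContinuousLinearMap.adjoint_inner_right, ← inner_conj_symm, RCLike.norm_conj]

/-- The quadratic form of a positive operator through its square root. -/
theorem inner_sqrt {A : H →L[ℂ] H} (hA : 0 ≤ A) (x y : H) :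
    ⟪x, A y⟫_ℂ = ⟪CFC.sqrt A x, CFC.sqrt A y⟫_ℂ := by
  have hs : IsSelfAdjoint (CFC.sqrt A) := IsSelfAdjoint.of_nonneg (CFC.sqrt_nonneg A)
  conv_lhs => rw [← CFC.sqrt_mul_sqrt_self A hA]
  rw [mul_apply_eq_comp, ← ContinuousLinearMap.adjoint_inner_left,
    ← ContinuousLinearMap.star_eq_adjoint, hs.star_eq]

theorem inner_self_sqrt {A : H →L[ℂ] H} (hA : 0 ≤ A) (x : H) :
    (⟪x, A x⟫_ℂ).re = ‖CFC.sqrt A x‖ ^ 2 := by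
  rw [inner_sqrt hA, inner_self_eq_norm_sq_to_K]
  simp [← Complex.ofReal_pow]

/-- The trace of a positive operator can be computed in every Hilbert basis. -/
theorem posTrace_eq {ι : Type*} (b : HilbertBasis ι ℂ H) {A : H →L[ℂ] H} (hA : 0 ≤ A) :
    posTrace A = ∑' i, ENNReal.ofReal (⟪b i, A (b i)⟫_ℂ).re := by
  have hs : IsSelfAdjoint (CFC.sqrt A) := IsSelfAdjoint.of_nonneg (CFC.sqrt_nonneg A)
  unfold posTrace
  simp_rw [inner_self_sqrt hA]
  rw [tsum_normSq_adjoint _ b, ← ContinuousLinearMap.star_eq_adjoint, hs.star_eq]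

/-- For a positive operator `A` of finite trace and a bounded operator `B`, the series for
`Tr (B A)` converges absolutely in every Hilbert basis. -/
theorem summable_trace_mul {ι : Type*} (b : HilbertBasis ι ℂ H) {A : H →L[ℂ] H} (hA : 0 ≤ A)
    (hfin : posTrace A ≠ ∞) (B : H →L[ℂ] H) :
    Summable fun i => ⟪b i, (B * A) (b i)⟫_ℂ := by
  set S := CFC.sqrt A with hSdef
  have hs : IsSelfAdjoint S := IsSelfAdjoint.of_nonneg (CFC.sqrt_nonneg A)
  have hsum : ∑' i, ENNReal.ofReal (‖S (b i)‖ ^ 2) ≠ ∞ := by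
    rw [posTrace_eq b hA] at hfin
    simpa only [inner_self_sqrt hA] using hfin
  have h1 : Summable fun i => ‖S (b i)‖ ^ 2 := by
    have := ENNReal.summable_toReal hsum
    simpa [ENNReal.toReal_ofReal] using this
  have h2 : Summable fun i => ‖(S * ContinuousLinearMap.adjoint B) (b i)‖ ^ 2 := by
    have : ∑' i, ENNReal.ofReal (‖(S * ContinuousLinearMap.adjoint B) (b i)‖ ^ 2) ≠ ∞ := by
      rw [tsum_normSq_adjoint b b, ← ContinuousLinearMap.star_eq_adjoint,
        ← ContinuousLinearMap.star_eq_adjoint, star_mul, star_star, hs.star_eq]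
      refine ne_top_of_le_ne_top (b := ENNReal.ofReal (‖B‖ ^ 2) *
        ∑' i, ENNReal.ofReal (‖S (b i)‖ ^ 2)) (ENNReal.mul_ne_top ENNReal.ofReal_ne_top hsum) ?_
      rw [← ENNReal.tsum_mul_left]
      refine ENNReal.tsum_le_tsum fun i => ?_
      rw [← ENNReal.ofReal_mul (by positivity), ← mul_pow, mul_apply_eq_comp]
      gcongr
      exact B.le_opNorm _
    have := ENNReal.summable_toReal this
    simpa [ENNReal.toReal_ofReal] using this
  refine Summable.of_norm_bounded (h2.add h1) fun i => ?_
  have e : ⟪b i, (B * A) (b i)⟫_ℂ = ⟪(S * ContinuousLinearMap.adjoint B) (b i), S (b i)⟫_ℂ := by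
    rw [mul_apply_eq_comp, ← ContinuousLinearMap.adjoint_inner_left, inner_sqrt hA]
    rfl
  rw [e]
  refine (norm_inner_le_norm _ _).trans ?_
  nlinarith [sq_nonneg (‖(S * ContinuousLinearMap.adjoint B) (b i)‖ - ‖S (b i)‖),
    sq_nonneg ‖(S * ContinuousLinearMap.adjoint B) (b i)‖, sq_nonneg ‖S (b i)‖]

end Trace

/-! ### The joint system of an `n`-bit string and a quantum system -/

/-- Bit strings of length `n`. -/
abbrev Bits (n : ℕ) : Type := Fin n → Bool

/-- The Hilbert space `ℂ^{Bits n} ⊗ H` of the joint system `XE`, realized as the Hilbert direct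
sum of copies of `H` indexed by the computational basis `|x⟩` of the register `X`. -/
abbrev Joint (n : ℕ) (H : Type*) : Type _ := PiLp 2 (fun _ : Bits n => H)

section Entropy

variable {n : ℕ} {H : Type*} [NormedAddCommGroup H] [InnerProductSpace ℂ H]

/-- The operator `∑ₓ |x⟩⟨x| ⊗ A x` on the joint system. -/
def blockDiag (A : Bits n → H →L[ℂ] H) : Joint n H →L[ℂ] Joint n H :=
  ((PiLp.continuousLinearEquiv 2 ℂ (fun _ : Bits n => H)).symm :
      (Bits n → H) →L[ℂ] Joint n H) ∘L
    ContinuousLinearMap.pi fun x => A x ∘L PiLp.proj 2 (fun _ : Bits n => H) x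

theorem blockDiag_apply (A : Bits n → H →L[ℂ] H) (ξ : Joint n H) (x : Bits n) :
    blockDiag A ξ x = A x (ξ x) := rfl

/-- The operator `1_X ⊗ σ` on the joint system. -/
def oneTensor (n : ℕ) (σ : H →L[ℂ] H) : Joint n H →L[ℂ] Joint n H :=
  blockDiag fun _ => σ

/-- The min-entropy of `τ` relative to `σ`:
`H_min(τ_XE | σ_E) = sup {h : τ ≤ 2^(-h) • (1_X ⊗ σ)}`, in `[-∞, ∞]`; in other words `-log₂ λ`
for the least `λ` with `λ • (1_X ⊗ σ) - τ ≥ 0`. -/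
def condMinEntropy (τ : Joint n H →L[ℂ] Joint n H) (σ : H →L[ℂ] H) : EReal :=
  ⨆ (h : ℝ) (_ : τ ≤ (((2 : ℝ) ^ (-h) : ℝ) : ℂ) • oneTensor n σ), (h : EReal)

variable [CompleteSpace H]

/-- The ball `B^ε(ρ)`: positive, not necessarily normalized operators `τ` on the joint system,
not necessarily classical on `X`, with `‖τ - ρ‖₁ ≤ ε`. -/
def smoothBall (ε : ℝ) (ρ : Joint n H →L[ℂ] Joint n H) : Set (Joint n H →L[ℂ] Joint n H) :=
  {τ | 0 ≤ τ ∧ traceNorm (τ - ρ) ≤ ENNReal.ofReal ε}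

/-- The smooth min-entropy
`H^ε_min(X|E)_ρ = sup_{τ ∈ B^ε(ρ)} sup_σ H_min(τ_XE | σ_E)`, where `σ` ranges over the density
operators of `E`. -/
def smoothMinEntropy (ε : ℝ) (ρ : Joint n H →L[ℂ] Joint n H) : EReal :=
  ⨆ (τ ∈ smoothBall ε ρ) (σ : H →L[ℂ] H) (_ : IsDensity σ), condMinEntropy τ σ

end Entropy

/-- `2 ^ h` for an extended real `h`, with `2 ^ (-∞) = 0` and `2 ^ ∞ = ∞`. -/
def twoPow (h : EReal) : ℝ≥0∞ := EReal.exp (h * (Real.log 2 : ℝ))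

theorem twoPow_coe (h : ℝ) : twoPow h = ENNReal.ofReal ((2 : ℝ) ^ h) := by
  rw [twoPow, ← EReal.coe_mul, EReal.exp_coe, Real.rpow_def_of_pos two_pos, mul_comm]

/-! ### The state shared by Bob and Eve, and Eve's strategies -/

section Guessing

variable (n : ℕ) (H : Type*) [NormedAddCommGroup H] [InnerProductSpace ℂ H] [CompleteSpace H]

/-- A joint state of a classical `n`-bit string `X` and a quantum system `E` with Hilbert space
`H`: for every `x` the subnormalized state `ρ_E^x` of `E`, whose trace is the probability of
`X = x`. -/
structure CQState where
  /-- The subnormalized conditional states. -/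
  cond : Bits n → H →L[ℂ] H
  nonneg : ∀ x, 0 ≤ cond x
  trace_eq_one : ∑ x, posTrace (cond x) = 1

/-- A strategy of Eve: a measurement (POVM) on `E` whose outcome is her guess of the `n`-bit
string. Any processing of `E` followed by a measurement and a decision is of this form. -/
structure Strategy where
  /-- The effect of the outcome `f`. -/
  effect : Bits n → H →L[ℂ] H
  nonneg : ∀ f, 0 ≤ effect f
  sum_eq_one : ∑ f, effect f = 1

variable {n H}

/-- The density operator `ρ_XE = ∑ₓ |x⟩⟨x| ⊗ ρ_E^x`. -/
def CQState.joint (ρ : CQState n H) : Joint n H →L[ℂ] Joint n H :=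
  blockDiag ρ.cond

/-- The joint distribution `P_XF(x, f) = Tr (M_f ρ_E^x)` of the string `X` and the guess `F`. -/
def jointProb (ρ : CQState n H) (M : Strategy n H) (x f : Bits n) : ℝ :=
  (trace (M.effect f * ρ.cond x)).re

/-- The average probability that the guess has at most `r` mistakes, i.e. that the Hamming
distance of `X` and `F` is at most `r`. -/
def successProb (ρ : CQState n H) (M : Strategy n H) (r : ℕ) : ℝ :=
  ∑ x, ∑ f with hammingDist x f ≤ r, jointProb ρ M x f

end Guessing

end QKey

end

open scoped ENNReal InnerProductSpace
open ContinuousLinearMap (adjoint)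

namespace QKey

/-! ### Hilbert–Schmidt sums and cyclicity of the trace -/

section HilbertSchmidt

variable {H K : Type*} [NormedAddCommGroup H] [InnerProductSpace ℂ H] [CompleteSpace H]
  [NormedAddCommGroup K] [InnerProductSpace ℂ K] [CompleteSpace K]

/-! The success probability is `Tr (Λ ρ)` for the effect `Λ = ∑ |x⟩⟨x| ⊗ M_f` over `d(x, f) ≤ r`,
which satisfies `0 ≤ Λ ≤ 1`. If `τ` is in the smoothing ball, then `ρ ≤ τ + |τ - ρ|`. The last term
costs at most `‖τ - ρ‖₁ ≤ ε` (`guessWeight_le_posTrace`). If also `τ ≤ 2^(-h) • (1 ⊗ σ)`, the first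
term costs at most `2^(-h) Tr (Λ (1 ⊗ σ))`, and `Tr (Λ (1 ⊗ σ))` is at most the volume of a Hamming
ball (`guessWeight_oneTensor_le`).

In infinite dimension `Tr (Λ A)` is handled as the sum of `⟨√M_f eᵢ, A_xx √M_f eᵢ⟩` in `[0, ∞]`,
with `A_xx` the diagonal block of `A` at `x`: each term is monotone in `A`, and no trace-class
condition is needed. The equality of the Hilbert–Schmidt norms of an operator and its adjoint
replaces cyclicity of the trace. -/

theorem tsum_normSq_eq_tsum_normSq_adjoint {ι κ : Type*} (b : HilbertBasis ι ℂ H)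
    (c : HilbertBasis κ ℂ K) (A : H →L[ℂ] K) :
    ∑' i, ENNReal.ofReal (‖A (b i)‖ ^ 2) = ∑' j, ENNReal.ofReal (‖adjoint A (c j)‖ ^ 2) := by
  simp_rw [← parseval c (A _), ← parseval b (adjoint A _)]
  rw [ENNReal.tsum_comm]
  refine tsum_congr fun j => tsum_congr fun i => ?_
  rw [ContinuousLinearMap.adjoint_inner_right, ← inner_conj_symm, RCLike.norm_conj]

theorem re_inner_apply_mono {A B : H →L[ℂ] H} (h : A ≤ B) (x : H) :
    (⟪x, A x⟫_ℂ).re ≤ (⟪x, B x⟫_ℂ).re := by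
  have := ((ContinuousLinearMap.le_def A B).1 h).re_inner_nonneg_right x
  rw [sub_apply, inner_sub_right] at this
  simpa using this

theorem re_inner_apply_nonneg {A : H →L[ℂ] H} (h : 0 ≤ A) (x : H) : 0 ≤ (⟪x, A x⟫_ℂ).re := by
  simpa using re_inner_apply_mono h x

theorem adjoint_sqrt (A : H →L[ℂ] H) : adjoint (CFC.sqrt A) = CFC.sqrt A := by
  rw [← ContinuousLinearMap.star_eq_adjoint,
    (IsSelfAdjoint.of_nonneg (CFC.sqrt_nonneg A)).star_eq]

theorem summable_normSq_comp_sqrt {ι : Type*} (b : HilbertBasis ι ℂ H) {A : H →L[ℂ] H}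
    (hA : 0 ≤ A) (hfin : posTrace A ≠ ∞) (B : H →L[ℂ] H) :
    Summable fun i => ‖B (CFC.sqrt A (b i))‖ ^ 2 := by
  have hsum : Summable fun i => ‖CFC.sqrt A (b i)‖ ^ 2 := by
    rw [posTrace_eq b hA] at hfin
    simp only [inner_self_sqrt hA] at hfin
    simpa [ENNReal.toReal_ofReal] using ENNReal.summable_toReal hfin
  refine Summable.of_nonneg_of_le (fun i => by positivity) (fun i => ?_)
    (hsum.mul_left (‖B‖ ^ 2))
  rw [← mul_pow]
  gcongr
  exact B.le_opNorm _

/-- `√A B` and its adjoint `B* √A` have the same Hilbert–Schmidt norm, which is finite because `√A`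
is Hilbert–Schmidt. -/
theorem hasSum_normSq_sqrt_comp {ι : Type*} (b : HilbertBasis ι ℂ H) {A : H →L[ℂ] H}
    (hA : 0 ≤ A) (hfin : posTrace A ≠ ∞) (B : H →L[ℂ] H) :
    HasSum (fun i => ‖CFC.sqrt A (B (b i))‖ ^ 2)
      (∑' i, ‖adjoint B (CFC.sqrt A (b i))‖ ^ 2) := by
  have hs := summable_normSq_comp_sqrt b hA hfin (adjoint B)
  have e := tsum_normSq_eq_tsum_normSq_adjoint b b (CFC.sqrt A ∘L B)
  rw [ContinuousLinearMap.adjoint_comp, adjoint_sqrt] at e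
  simp only [ContinuousLinearMap.comp_apply] at e
  have e2 := ENNReal.ofReal_tsum_of_nonneg (fun i => by positivity) hs
  have hne : ∑' i, ENNReal.ofReal (‖CFC.sqrt A (B (b i))‖ ^ 2) ≠ ∞ := by
    rw [e, ← e2]
    exact ENNReal.ofReal_ne_top
  have hs2 : Summable fun i => ‖CFC.sqrt A (B (b i))‖ ^ 2 := by
    simpa [ENNReal.toReal_ofReal] using ENNReal.summable_toReal hne
  have e3 := ENNReal.ofReal_tsum_of_nonneg (fun i => by positivity) hs2
  rw [← e2, ← e3, ENNReal.ofReal_eq_ofReal_iff (tsum_nonneg fun i => by positivity)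
    (tsum_nonneg fun i => by positivity)] at e
  exact e ▸ hs2.hasSum

/-- `Tr (M A) = Tr (√M A √M)` for positive `M` and positive `A` of finite trace. -/
theorem ofReal_re_trace_mul {ι : Type*} (b : HilbertBasis ι ℂ H) {A M : H →L[ℂ] H}
    (hA : 0 ≤ A) (hfin : posTrace A ≠ ∞) (hM : 0 ≤ M) :
    0 ≤ (trace (M * A)).re ∧ ENNReal.ofReal (trace (M * A)).re =
      ∑' i, ENNReal.ofReal (⟪CFC.sqrt M (b i), A (CFC.sqrt M (b i))⟫_ℂ).re := by
  have hMadj : adjoint M = M := by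
    rw [← ContinuousLinearMap.star_eq_adjoint, (IsSelfAdjoint.of_nonneg hM).star_eq]
  have polar : ∀ u v : H, (⟪u, v⟫_ℂ).re = (‖u + v‖ ^ 2 - ‖u - v‖ ^ 2) / 4 := fun u v => by
    have h1 := norm_add_sq (𝕜 := ℂ) u v
    have h2 := norm_sub_sq (𝕜 := ℂ) u v
    simp only [RCLike.re_to_complex] at h1 h2
    linarith
  set e := stdBasis H
  set S := CFC.sqrt A with hS
  -- Polarization: norms with `M ± 1` yield the sesquilinear identity `∑ Re ⟨S M eᵢ, S eᵢ⟩ = ∑ Re ⟨M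
  -- S eᵢ, S eᵢ⟩`.
  have hp := hasSum_normSq_sqrt_comp e hA hfin (M + 1)
  have hm := hasSum_normSq_sqrt_comp e hA hfin (M - 1)
  have hp' := (summable_normSq_comp_sqrt e hA hfin (adjoint (M + 1))).hasSum
  have hm' := (summable_normSq_comp_sqrt e hA hfin (adjoint (M - 1))).hasSum
  have key := (hp.sub hm).div_const 4
  have key' := (hp'.sub hm').div_const 4
  have hadj1 : adjoint (1 : H →L[ℂ] H) = 1 := by
    rw [← ContinuousLinearMap.star_eq_adjoint, star_one]
  simp only [map_add, map_sub, hMadj, hadj1, add_apply,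
    sub_apply, one_apply_eq_self, ← hS] at key key'
  simp only [← polar] at key key'
  have hre : HasSum (fun i => (⟪e i, (M * A) (e i)⟫_ℂ).re) (trace (M * A)).re := by
    exact (summable_trace_mul e hA hfin M).hasSum.mapL Complex.reCLM
  have hre' : (fun i => (⟪e i, (M * A) (e i)⟫_ℂ).re) =
      fun i => (⟪S (M (e i)), S (e i)⟫_ℂ).re := by
    ext i
    rw [← inner_sqrt hA, mul_apply_eq_comp, ← ContinuousLinearMap.adjoint_inner_left, hMadj]
  rw [hre'] at hre
  have htr := hre.unique key
  have hnn : ∀ i, (⟪M (S (e i)), S (e i)⟫_ℂ).re = ‖CFC.sqrt M (S (e i))‖ ^ 2 := fun i => by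
    rw [← inner_self_sqrt hM, ← ContinuousLinearMap.adjoint_inner_left M, hMadj]
  simp only [hnn] at key'
  have hval := key'.tsum_eq
  rw [← htr] at hval
  refine ⟨hval ▸ tsum_nonneg fun i => by positivity, ?_⟩
  rw [← hval, ENNReal.ofReal_tsum_of_nonneg (fun i => by positivity) key'.summable]
  simp_rw [inner_self_sqrt hA]
  -- Passing from `√M S` to its adjoint `S √M` also changes the basis from `e` to `b`.
  have := tsum_normSq_eq_tsum_normSq_adjoint e b (CFC.sqrt M ∘L S)
  rwa [ContinuousLinearMap.adjoint_comp, adjoint_sqrt, hS, adjoint_sqrt] at this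

/-- Take `D = |A - B|`: then `A + D - B = |A - B| + (A - B)` is twice the positive part of `A - B`.
-/
theorem exists_le_add_of_traceNorm {A B : H →L[ℂ] H} (hA : IsSelfAdjoint A)
    (hB : IsSelfAdjoint B) : ∃ D, 0 ≤ D ∧ B ≤ A + D ∧ posTrace D = traceNorm (A - B) := by
  refine ⟨CFC.abs (A - B), CFC.abs_nonneg _, ?_, rfl⟩
  have h : 0 ≤ CFC.abs (A - B) + (A - B) := by
    rw [CFC.abs_add_self (A - B) (hA.sub hB)]
    exact nsmul_nonneg (CFC.posPart_nonneg _) 2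
  have h2 : CFC.abs (A - B) + (A - B) = A + CFC.abs (A - B) - B := by abel
  rwa [h2, sub_nonneg] at h

end HilbertSchmidt

/-! ### The volume of a Hamming ball -/

/-- Over a binary alphabet, `x` is determined by `f` and the set of positions where they differ. -/
theorem card_hammingBall_le (n r : ℕ) (f : Bits n) :
    (Finset.univ.filter fun x : Bits n => hammingDist x f ≤ r).card ≤
      ∑ k ∈ Finset.range (r + 1), n.choose k := by
  have hcard : ∀ k, n.choose k =
      (Finset.powersetCard k (Finset.univ : Finset (Fin n))).card := fun k => by simp
  simp_rw [hcard]
  refine le_trans ?_ Finset.card_biUnion_le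
  refine Finset.card_le_card_of_injOn (fun x => Finset.univ.filter fun i => x i ≠ f i)
    (fun x hx => ?_) (fun x _ y _ hxy => ?_)
  · simp only [Finset.coe_filter, Finset.mem_univ, true_and, Set.mem_ofPred_eq] at hx
    simp only [Finset.coe_biUnion, Set.mem_iUnion, Finset.mem_coe, Finset.mem_powersetCard]
    exact ⟨hammingDist x f, by simpa [Nat.lt_succ_iff] using hx, Finset.subset_univ _, rfl⟩
  · ext i
    have := Finset.ext_iff.1 hxy i
    simp only [Finset.mem_filter, Finset.mem_univ, true_and] at this
    cases hx : x i <;> cases hy : y i <;> cases hf : f i <;> simp_all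

/-! ### The joint system -/

section Joint

variable {n : ℕ} {H : Type*} [NormedAddCommGroup H] [InnerProductSpace ℂ H] [CompleteSpace H]

/-- The isometry `v ↦ |x⟩ ⊗ v`. -/
noncomputable def ket (x : Bits n) : H →L[ℂ] Joint n H :=
  adjoint (PiLp.proj 2 (fun _ : Bits n => H) x)

theorem adjoint_ket (x : Bits n) :
    adjoint (ket x) = PiLp.proj (𝕜 := ℂ) 2 (fun _ : Bits n => H) x :=
  ContinuousLinearMap.adjoint_adjoint _

theorem inner_ket_left (x : Bits n) (v : H) (ξ : Joint n H) : ⟪ket x v, ξ⟫_ℂ = ⟪v, ξ x⟫_ℂ :=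
  ContinuousLinearMap.adjoint_inner_left _ _ _

theorem ket_apply_self (x : Bits n) (v : H) : ket x v x = v := by
  refine ext_inner_right ℂ fun w => ?_
  have h := inner_ket_left x v (PiLp.single 2 x w)
  rw [PiLp.single_eq_same] at h
  rw [← h, PiLp.inner_apply, Finset.sum_eq_single x]
  · simp
  · intro y _ hy
    simp [hy]
  · simp

theorem inner_ket_blockDiag (A : Bits n → H →L[ℂ] H) (x : Bits n) (v : H) :
    ⟪ket x v, blockDiag A (ket x v)⟫_ℂ = ⟪v, A x v⟫_ℂ := by
  rw [inner_ket_left, blockDiag_apply, ket_apply_self]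

theorem isSelfAdjoint_blockDiag {A : Bits n → H →L[ℂ] H} (hA : ∀ x, IsSelfAdjoint (A x)) :
    IsSelfAdjoint (blockDiag A) := by
  rw [ContinuousLinearMap.isSelfAdjoint_iff']
  refine ((ContinuousLinearMap.eq_adjoint_iff _ _).2 fun ξ η => ?_).symm
  simp only [PiLp.inner_apply, blockDiag_apply]
  refine Finset.sum_congr rfl fun x _ => ?_
  rw [← ContinuousLinearMap.adjoint_inner_right, ← ContinuousLinearMap.star_eq_adjoint,
    (hA x).star_eq]

/-- The value `Tr (Λ A)` of the effect `Λ = ∑ |x⟩⟨x| ⊗ M_f`, summed over `d(x, f) ≤ r`, on a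
positive operator `A` of the joint system. -/
noncomputable def guessWeight (M : Strategy n H) (r : ℕ) (A : Joint n H →L[ℂ] Joint n H) : ℝ≥0∞ :=
  ∑ x, ∑ f with hammingDist x f ≤ r, ∑' i, ENNReal.ofReal
    (⟪ket x (CFC.sqrt (M.effect f) (stdBasis H i)),
      A (ket x (CFC.sqrt (M.effect f) (stdBasis H i)))⟫_ℂ).re

theorem guessWeight_mono (M : Strategy n H) (r : ℕ) {A B : Joint n H →L[ℂ] Joint n H}
    (h : A ≤ B) : guessWeight M r A ≤ guessWeight M r B :=
  Finset.sum_le_sum fun _ _ => Finset.sum_le_sum fun _ _ => ENNReal.tsum_le_tsum fun _ =>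
    ENNReal.ofReal_le_ofReal (re_inner_apply_mono h _)

/-- Positivity matters because `ENNReal.ofReal` truncates negative values to zero. -/
theorem guessWeight_add (M : Strategy n H) (r : ℕ) {A B : Joint n H →L[ℂ] Joint n H}
    (hA : 0 ≤ A) (hB : 0 ≤ B) :
    guessWeight M r (A + B) = guessWeight M r A + guessWeight M r B := by
  simp only [guessWeight, ← Finset.sum_add_distrib, ← ENNReal.tsum_add,
    add_apply, inner_add_right, Complex.add_re]
  simp only [ENNReal.ofReal_add (re_inner_apply_nonneg hA _) (re_inner_apply_nonneg hB _)]

theorem guessWeight_smul (M : Strategy n H) (r : ℕ) {c : ℝ} (hc : 0 ≤ c)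
    (A : Joint n H →L[ℂ] Joint n H) :
    guessWeight M r ((c : ℂ) • A) = ENNReal.ofReal c * guessWeight M r A := by
  simp only [guessWeight, smul_apply, inner_smul_right, Complex.re_ofReal_mul,
    ENNReal.ofReal_mul hc, ENNReal.tsum_mul_left, Finset.mul_sum]

theorem posTrace_cond_ne_top (ρ : CQState n H) (x : Bits n) : posTrace (ρ.cond x) ≠ ∞ :=
  ne_top_of_le_ne_top ENNReal.one_ne_top (ρ.trace_eq_one ▸
    Finset.single_le_sum (f := fun x => posTrace (ρ.cond x)) (fun _ _ => zero_le)
      (Finset.mem_univ x))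

theorem ofReal_successProb (ρ : CQState n H) (M : Strategy n H) (r : ℕ) :
    ENNReal.ofReal (successProb ρ M r) = guessWeight M r ρ.joint := by
  have h x f := ofReal_re_trace_mul (stdBasis H) (ρ.nonneg x) (posTrace_cond_ne_top ρ x)
    (M.nonneg f)
  unfold successProb guessWeight jointProb
  rw [ENNReal.ofReal_sum_of_nonneg fun x _ => Finset.sum_nonneg fun f _ => (h x f).1]
  refine Finset.sum_congr rfl fun x _ => ?_
  rw [ENNReal.ofReal_sum_of_nonneg fun f _ => (h x f).1]
  refine Finset.sum_congr rfl fun f _ => ?_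
  simp only [(h x f).2, CQState.joint, inner_ket_blockDiag]

/-- The probabilities of the outcomes of a measurement add up. -/
theorem sum_normSq_sqrt_effect (M : Strategy n H) (v : H) :
    ∑ f, ENNReal.ofReal (‖CFC.sqrt (M.effect f) v‖ ^ 2) = ENNReal.ofReal (‖v‖ ^ 2) := by
  rw [← ENNReal.ofReal_sum_of_nonneg fun f _ => by positivity]
  congr 1
  simp only [← inner_self_sqrt (M.nonneg _), ← Complex.re_sum, ← inner_sum,
    ← sum_apply, M.sum_eq_one, one_apply_eq_self,
    inner_self_eq_norm_sq_to_K]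
  simp [← Complex.ofReal_pow]

/-- Since the weight does not depend on `x`, summing over `x` first counts the ball around each `f`;
then `∑ Tr (M_f σ) = Tr σ`. -/
theorem guessWeight_oneTensor_le (M : Strategy n H) (r : ℕ) {σ : H →L[ℂ] H} (hσ : 0 ≤ σ) :
    guessWeight M r (oneTensor n σ) ≤
      ((∑ k ∈ Finset.range (r + 1), n.choose k : ℕ) : ℝ≥0∞) * posTrace σ := by
  have h : ∀ f, ∑' i, ENNReal.ofReal (⟪CFC.sqrt (M.effect f) (stdBasis H i),
      σ (CFC.sqrt (M.effect f) (stdBasis H i))⟫_ℂ).re =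
      ∑' i, ENNReal.ofReal (‖CFC.sqrt (M.effect f) (CFC.sqrt σ (stdBasis H i))‖ ^ 2) := fun f => by
    have := tsum_normSq_eq_tsum_normSq_adjoint (stdBasis H) (stdBasis H)
      (CFC.sqrt σ ∘L CFC.sqrt (M.effect f))
    rw [ContinuousLinearMap.adjoint_comp, adjoint_sqrt, adjoint_sqrt] at this
    simp only [inner_self_sqrt hσ]
    exact this
  simp only [guessWeight, oneTensor, inner_ket_blockDiag, h]
  simp only [Finset.sum_filter]
  rw [Finset.sum_comm]
  simp only [← Finset.sum_filter, Finset.sum_const, nsmul_eq_mul]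
  calc _ ≤ ∑ f, ((∑ k ∈ Finset.range (r + 1), n.choose k : ℕ) : ℝ≥0∞) *
          ∑' i, ENNReal.ofReal (‖CFC.sqrt (M.effect f) (CFC.sqrt σ (stdBasis H i))‖ ^ 2) :=
        Finset.sum_le_sum fun f _ => mul_le_mul_left
          (Nat.cast_le.2 (card_hammingBall_le n r f)) _
    _ = _ := by
        rw [← Finset.mul_sum, ← Summable.tsum_finsetSum fun _ _ => ENNReal.summable]
        simp only [sum_normSq_sqrt_effect, posTrace, inner_self_sqrt hσ]

/-- This is `Λ ≤ 1`: without the distance constraint, the effects sum to the identity for each `x`.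
-/
theorem guessWeight_le_posTrace (M : Strategy n H) (r : ℕ) {A : Joint n H →L[ℂ] Joint n H}
    (hA : 0 ≤ A) : guessWeight M r A ≤ posTrace A := by
  set b := stdBasis (Joint n H) with hb
  have h : ∀ x f, ∑' i, ENNReal.ofReal (⟪ket x (CFC.sqrt (M.effect f) (stdBasis H i)),
      A (ket x (CFC.sqrt (M.effect f) (stdBasis H i)))⟫_ℂ).re =
      ∑' j, ENNReal.ofReal (‖CFC.sqrt (M.effect f) (CFC.sqrt A (b j) x)‖ ^ 2) := fun x f => by
    have := tsum_normSq_eq_tsum_normSq_adjoint (stdBasis H) b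
      (CFC.sqrt A ∘L ket x ∘L CFC.sqrt (M.effect f))
    rw [ContinuousLinearMap.adjoint_comp, ContinuousLinearMap.adjoint_comp, adjoint_sqrt,
      adjoint_sqrt, adjoint_ket] at this
    simp only [inner_self_sqrt hA]
    exact this
  simp only [guessWeight, h]
  calc _ ≤ ∑ x, ∑ f, ∑' j, ENNReal.ofReal (‖CFC.sqrt (M.effect f) (CFC.sqrt A (b j) x)‖ ^ 2) :=
        Finset.sum_le_sum fun x _ => Finset.sum_le_sum_of_subset (Finset.filter_subset _ _)
    _ = ∑' j, ∑ x, ENNReal.ofReal (‖CFC.sqrt A (b j) x‖ ^ 2) := by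
        simp only [← Summable.tsum_finsetSum fun _ _ => ENNReal.summable, sum_normSq_sqrt_effect]
    _ = posTrace A := by
        rw [posTrace, ← hb]
        refine tsum_congr fun j => ?_
        rw [inner_self_sqrt hA, PiLp.norm_sq_eq_of_L2,
          ENNReal.ofReal_sum_of_nonneg fun x _ => by positivity]

theorem ofReal_successProb_le (ρ : CQState n H) (M : Strategy n H) (r : ℕ) {ε h : ℝ}
    {τ : Joint n H →L[ℂ] Joint n H} {σ : H →L[ℂ] H} (hτ : τ ∈ smoothBall ε ρ.joint)
    (hσ : IsDensity σ) (hle : τ ≤ (((2 : ℝ) ^ (-h) : ℝ) : ℂ) • oneTensor n σ) :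
    ENNReal.ofReal (successProb ρ M r) ≤
      ((∑ k ∈ Finset.range (r + 1), n.choose k : ℕ) : ℝ≥0∞) * ENNReal.ofReal ((2 : ℝ) ^ (-h)) +
        ENNReal.ofReal ε := by
  rw [ofReal_successProb]
  obtain ⟨D, hD, hle', htr⟩ := exists_le_add_of_traceNorm (B := ρ.joint)
    (IsSelfAdjoint.of_nonneg hτ.1)
    (isSelfAdjoint_blockDiag fun x => IsSelfAdjoint.of_nonneg (ρ.nonneg x))
  calc guessWeight M r ρ.joint
      ≤ guessWeight M r (τ + D) := guessWeight_mono M r hle'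
    _ = guessWeight M r τ + guessWeight M r D := guessWeight_add M r hτ.1 hD
    _ ≤ _ := by
        refine add_le_add ((guessWeight_mono M r hle).trans ?_)
          ((guessWeight_le_posTrace M r hD).trans (htr.trans_le hτ.2))
        rw [guessWeight_smul M r (by positivity), mul_comm]
        gcongr
        simpa [hσ.trace_eq_one] using guessWeight_oneTensor_le M r hσ.nonneg

end Joint

end QKey

theorem proposition1 {n : ℕ} {H : Type*} [NormedAddCommGroup H] [InnerProductSpace ℂ H]
    [CompleteSpace H] (ρ : QKey.CQState n H) (ε : ℝ) (hε : 0 ≤ ε) (r : ℕ)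
    (M : QKey.Strategy n H) :
    ENNReal.ofReal (QKey.successProb ρ M r) ≤
      ((∑ k ∈ Finset.range (r + 1), n.choose k : ℕ) : ℝ≥0∞) *
          QKey.twoPow (-QKey.smoothMinEntropy ε ρ.joint) + ENNReal.ofReal ε := by
  set p := QKey.successProb ρ M r
  set N : ℕ := ∑ k ∈ Finset.range (r + 1), n.choose k with hN
  have hNpos : (0 : ℝ) < N := by
    rw [Nat.cast_pos, hN]
    exact Finset.sum_pos' (fun _ _ => Nat.zero_le _) ⟨0, by simp, by simp⟩
  -- The trivial case is split off so that `c` below is positive and has a logarithm.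
  rcases le_or_gt p ε with hp | hp
  · exact (ENNReal.ofReal_le_ofReal hp).trans le_add_self
  -- The value of `2^(-h)` at which the bound for a single `h` becomes an equality; every admissible
  -- `h` is thus at most `-log₂ c`.
  set c := (p - ε) / N with hc
  have hcpos : 0 < c := div_pos (sub_pos.2 hp) hNpos
  have hcN : p = N * c + ε := by
    rw [hc]
    field_simp
    ring
  have hS : QKey.smoothMinEntropy ε ρ.joint ≤ ((-Real.logb 2 c : ℝ) : EReal) := by
    refine iSup₂_le fun τ hτ => iSup₂_le fun σ hσ => iSup₂_le fun h hle => ?_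
    have hb := QKey.ofReal_successProb_le ρ M r hτ hσ hle
    rw [← ENNReal.ofReal_natCast, ← ENNReal.ofReal_mul hNpos.le,
      ← ENNReal.ofReal_add (by positivity) hε, ENNReal.ofReal_le_ofReal_iff (by positivity)] at hb
    have hch : c ≤ (2 : ℝ) ^ (-h) := le_of_mul_le_mul_left (by linarith) hNpos
    rw [EReal.coe_le_coe_iff, le_neg]
    exact (Real.logb_le_iff_le_rpow one_lt_two hcpos).2 hch
  -- The finite bound `hS` rules out entropy `∞`; entropy `-∞` needs no separate case, by
  -- monotonicity of `EReal.exp`.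
  have hpow : ENNReal.ofReal c ≤ QKey.twoPow (-QKey.smoothMinEntropy ε ρ.joint) := by
    have h1 : ((Real.logb 2 c : ℝ) : EReal) ≤ -QKey.smoothMinEntropy ε ρ.joint := by
      rw [EReal.le_neg]
      simpa using hS
    calc ENNReal.ofReal c = QKey.twoPow (Real.logb 2 c : ℝ) := by
          rw [QKey.twoPow_coe, Real.rpow_logb two_pos (by norm_num) hcpos]
      _ ≤ _ := EReal.exp_monotone (mul_le_mul_of_nonneg_right h1
          (EReal.coe_nonneg.2 (Real.log_nonneg one_le_two)))
  rw [hcN, ENNReal.ofReal_add (by positivity) hε, ENNReal.ofReal_mul hNpos.le,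
    ENNReal.ofReal_natCast]
  gcongr
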